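/- All graphs are finite directed graphs; loops and parallel arcs are allowed. A path from $v$ to $v'$ is a sequence of $k\ge 1$ pairwise distinct consecutive arcs $a_1,\dots,a_k$ that starts at $v$ and ends at $v'$; a cycle is a closed path (up to cyclic shift) that does not pass through the same node twice. A graph is strongly connected if for any two nodes $v\neq v'$ there are a path from $v$ to $v'$ and a path from $v'$ to $v$. For a strongly connected graph $\Gamma$ with at least one arc put $$f_\Gamma=\min\Big\{\sum_{a} x_a \;:\; x_a\ge 0 \text{ for every arc } a,\ \prod_{a\in\gamma}x_a=1\text{ for every cycle }\gamma\text{ of }\Gamma\Big\},$$ where the sum is over all arcs of $\Gamma$. A rooted tree $T$ is a graph with a distinguished node $\rho$ (the root), at which no arc ends, such that for every node $v\ne\rho$ there is a unique path from $\rho$ to $v$. A leaf is a node with no outgoing arc. Put $$m_T=\min\Big\{\sum_{v} y_v \;:\; y_v>0\text{ for every node } v,\ \prod_{v\in[\rho,\lambda]}y_v=1\text{ for every leaf }\lambda\Big\},$$ where the sum is over all nodes of $T$ and $[\rho,\lambda]$ is the set of nodes on the path from $\rho$ to $\lambda$, both ends included. Let $m\ge n\ge 2$ be integers and $\ell=m-n+1$.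 Let $\mathfrak G_{m,n}$ be the set of (isomorphism classes of) strongly connected graphs with $m$ arcs and $n$ nodes, and let $\mathcal T(m,\ell)$ be the set of (isomorphism classes of) rooted trees with $m$ nodes and $\ell$ leaves. Then the minima defining $f_\Gamma$ for $\Gamma\in\mathfrak G_{m,n}$ and $m_T$ for $T\in\mathcal T(m,\ell)$ are attained, the two minima below exist, and $$\min_{\Gamma\in\mathfrak G_{m,n}} f_\Gamma=\min_{T\in\mathcal T(m,\ell)} m_T .$$ -/

import Mathlib

/-- A finite directed graph. Loops and parallel arcs are allowed; `src a` and `tgt a` are the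
beginning and the end of the arc `a`. -/
structure MGraph where
  V : Type
  A : Type
  [fintypeV : Fintype V]
  [fintypeA : Fintype A]
  src : A → V
  tgt : A → V

attribute [instance] MGraph.fintypeV MGraph.fintypeA

namespace MGraph

/-- `Γ.IsWalk v l w`: the consecutive arcs of the list `l` lead from the node `v` to the node `w`
(the empty list leads from `v` to `v`). -/
def IsWalk (Γ : MGraph) : Γ.V → List Γ.A → Γ.V → Prop
  | v, [], w => v = w
  | v, a :: l, w => Γ.src a = v ∧ Γ.IsWalk (Γ.tgt a) l w

/-- A path: a nonempty sequence of consecutive, pairwise distinct arcs. -/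
def IsPath (Γ : MGraph) (v : Γ.V) (l : List Γ.A) (w : Γ.V) : Prop :=
  l ≠ [] ∧ l.Nodup ∧ Γ.IsWalk v l w

/-- The list `l` is a closed path that does not pass through the same node twice. A cycle is the
class of such a list up to cyclic shifts; its support is the set of members of `l`. -/
def IsCycle (Γ : MGraph) (l : List Γ.A) : Prop :=
  (∃ v, Γ.IsPath v l v) ∧ (l.map Γ.src).Nodup

/-- Any two distinct nodes are joined by a path (in both directions, since the pair is ordered). -/
def StronglyConnected (Γ : MGraph) : Prop :=
  ∀ v w : Γ.V, v ≠ w → ∃ l, Γ.IsPath v l w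

/-- The arc values `x ≥ 0` for which the product over every cycle equals `1`. -/
def Admissible (Γ : MGraph) (x : Γ.A → ℝ) : Prop :=
  (∀ a, 0 ≤ x a) ∧ ∀ l, Γ.IsCycle l → (l.map x).prod = 1

/-- The values of the objective function, the sum of all arc values. -/
def arcSums (Γ : MGraph) : Set ℝ :=
  {s | ∃ x : Γ.A → ℝ, Γ.Admissible x ∧ s = ∑ a, x a}

/-- The quantity `f_Γ`. -/
noncomputable def fMin (Γ : MGraph) : ℝ := sInf Γ.arcSums

end MGraph

/-- The strongly connected graphs with `m` arcs and `n` nodes. -/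
def stronglyConnectedGraphs (m n : ℕ) : Set MGraph :=
  {Γ | Γ.StronglyConnected ∧ Fintype.card Γ.A = m ∧ Fintype.card Γ.V = n}

/-- A rooted tree: a graph with a root, at which no arc ends, such that for any other node there
is a unique path from the root to that node. -/
structure NodeTree extends MGraph where
  root : V
  tgt_ne_root : ∀ a, tgt a ≠ root
  existsUnique_path : ∀ v, v ≠ root → ∃! l, toMGraph.IsPath root l v

namespace NodeTree

/-- The natural partial order on the nodes. -/
def Le (T : NodeTree) (v w : T.V) : Prop :=
  v = w ∨ ∃ l, T.IsPath v l w

/-- A leaf is a node without outgoing arcs. -/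
def IsLeaf (T : NodeTree) (v : T.V) : Prop :=
  ∀ a, T.src a ≠ v

open Classical in
/-- The product of the node values over the interval `[v, w]`. -/
noncomputable def intervalProd (T : NodeTree) (y : T.V → ℝ) (v w : T.V) : ℝ :=
  ∏ u with T.Le v u ∧ T.Le u w, y u

/-- The node values `y > 0` for which the product over every path from the root to a leaf
equals `1`. -/
def Admissible (T : NodeTree) (y : T.V → ℝ) : Prop :=
  (∀ v, 0 < y v) ∧ ∀ v, T.IsLeaf v → T.intervalProd y T.root v = 1

/-- The values of the objective function, the sum of all node values. -/
def nodeSums (T : NodeTree) : Set ℝ :=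
  {s | ∃ y : T.V → ℝ, T.Admissible y ∧ s = ∑ v, y v}

/-- The quantity `m_T`. -/
noncomputable def mMin (T : NodeTree) : ℝ := sInf T.nodeSums

end NodeTree

/-- The rooted trees with `m` nodes and `l` leaves. -/
def rootedTrees (m l : ℕ) : Set NodeTree :=
  {T | Fintype.card T.V = m ∧ {v | T.IsLeaf v}.ncard = l}

/-! On a strongly connected graph the admissible arc values are exactly the quotients `p (tgt a) / p
(src a)` of a positive potential `p` (`Admissible.exists_potential`, `admissible_potential`). From
tree to graph: gluing all leaves into one node and adding an arc from it to the root turns node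
values into arc values with the same sum; the products from the root are the potential
(`closure_mem`, `admissible_closure`). From graph to tree (`exists_tree_le`): let `o` minimise `p`
and let `e v` be the last arc of a shortest walk from `o` to `v ≠ o`. One arc `e r` starting at `o`
becomes the root. Redirecting to `o` every arc that is not some `e v`, and moving to `r` the source
of every other arc that starts at `o`, increases no quotient. The arcs are then the nodes of a tree
whose `n - 1` inner nodes are the `e v`. Compactness yields each single minimum. The trees give only
finitely many values `m_T`, so a least one exists, and the two constructions carry it over to the
graphs. -/

/-! ### Walks, cycles and potentials -/

namespace MGraph

variable {Γ : MGraph}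

theorem isWalk_append {v w : Γ.V} {l k : List Γ.A} :
    Γ.IsWalk v (l ++ k) w ↔ ∃ u, Γ.IsWalk v l u ∧ Γ.IsWalk u k w := by
  induction l generalizing v with
  | nil => simp [IsWalk]
  | cons a l ih => simp [IsWalk, ih, and_assoc]

theorem isWalk_concat {v w : Γ.V} {l : List Γ.A} {a : Γ.A} :
    Γ.IsWalk v (l ++ [a]) w ↔ Γ.IsWalk v l (Γ.src a) ∧ Γ.tgt a = w := by
  simp [isWalk_append, IsWalk]

theorem IsWalk.append {u v w : Γ.V} {l k : List Γ.A} (h₁ : Γ.IsWalk u l v)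
    (h₂ : Γ.IsWalk v k w) : Γ.IsWalk u (l ++ k) w :=
  isWalk_append.2 ⟨v, h₁, h₂⟩

/-- A list with a repetition of `f`-values splits at two places with the same value. -/
theorem exists_split_of_not_nodup_map {α β : Type*} (f : α → β) {l : List α}
    (h : ¬ (l.map f).Nodup) :
    ∃ l₁ l₂ l₃ a b, l = l₁ ++ (a :: l₂) ++ (b :: l₃) ∧ f a = f b := by
  induction l with
  | nil => simp at h
  | cons c l ih =>
    by_cases hc : f c ∈ l.map f
    · obtain ⟨b, hb, hbc⟩ := List.mem_map.1 hc
      obtain ⟨s, t, rfl⟩ := List.append_of_mem hb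
      exact ⟨[], s, t, c, b, by simp, hbc.symm⟩
    · have : ¬ (l.map f).Nodup := fun h' => h (by simpa using ⟨by simpa using hc, h'⟩)
      obtain ⟨l₁, l₂, l₃, a, b, rfl, hab⟩ := ih this
      exact ⟨c :: l₁, l₂, l₃, a, b, by simp, hab⟩

/-- A walk that passes twice through a node splits into a closed walk and a shorter walk. -/
theorem IsWalk.split {v w : Γ.V} {l₁ l₂ l₃ : List Γ.A} {a b : Γ.A}
    (h : Γ.IsWalk v (l₁ ++ (a :: l₂) ++ (b :: l₃)) w) (hab : Γ.src a = Γ.src b) :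
    Γ.IsWalk v (l₁ ++ b :: l₃) w ∧ Γ.IsWalk (Γ.src a) (a :: l₂) (Γ.src a) := by
  obtain ⟨u, h₁, h₃⟩ := isWalk_append.1 h
  obtain ⟨u', h₁, h₂⟩ := isWalk_append.1 h₁
  obtain rfl : Γ.src b = u := h₃.1
  obtain rfl : Γ.src a = u' := h₂.1
  refine ⟨h₁.append (by rwa [hab]), ?_⟩
  rwa [← hab] at h₂

theorem IsWalk.exists_nodup {v w : Γ.V} {l : List Γ.A} (h : Γ.IsWalk v l w) :
    ∃ k : List Γ.A, k.Nodup ∧ Γ.IsWalk v k w := by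
  induction hn : l.length using Nat.strong_induction_on generalizing l with
  | _ n ih =>
    by_cases hl : l.Nodup
    · exact ⟨l, hl, h⟩
    · obtain ⟨l₁, l₂, l₃, a, b, rfl, hab⟩ :=
        exists_split_of_not_nodup_map (id : Γ.A → Γ.A) (l := l) (by simpa using hl)
      obtain rfl : a = b := hab
      exact ih _ (by rw [← hn]; simp) (h.split rfl).1 rfl

theorem IsWalk.exists_isPath {v w : Γ.V} {l : List Γ.A} (h : Γ.IsWalk v l w) (hvw : v ≠ w) :
    ∃ k, Γ.IsPath v k w := by
  obtain ⟨k, hk, hw⟩ := h.exists_nodup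
  refine ⟨k, ?_, hk, hw⟩
  rintro rfl
  exact hvw hw

theorem StronglyConnected.exists_isWalk (h : Γ.StronglyConnected) (v w : Γ.V) :
    ∃ l, Γ.IsWalk v l w := by
  by_cases hvw : v = w
  · exact ⟨[], hvw⟩
  · obtain ⟨l, hl⟩ := h v w hvw
    exact ⟨l, hl.2.2⟩

theorem stronglyConnected_of_base (o : Γ.V) (h₁ : ∀ v, ∃ l, Γ.IsWalk o l v)
    (h₂ : ∀ v, ∃ l, Γ.IsWalk v l o) : Γ.StronglyConnected := by
  intro v w hvw
  obtain ⟨l, hl⟩ := h₂ v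
  obtain ⟨k, hk⟩ := h₁ w
  exact (hl.append hk).exists_isPath hvw

/-- A closed walk that repeats a node splits into two shorter closed walks; one that does not is
empty or a cycle. -/
theorem Admissible.prod_closed {x : Γ.A → ℝ} (hx : Γ.Admissible x) {v : Γ.V} {l : List Γ.A}
    (h : Γ.IsWalk v l v) : (l.map x).prod = 1 := by
  induction hn : l.length using Nat.strong_induction_on generalizing l v with
  | _ n ih =>
    by_cases hl : (l.map Γ.src).Nodup
    · rcases eq_or_ne l [] with rfl | hne
      · simp
      · exact hx.2 l ⟨⟨v, hne, List.Nodup.of_map _ hl, h⟩, hl⟩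
    · obtain ⟨l₁, l₂, l₃, a, b, rfl, hab⟩ := exists_split_of_not_nodup_map Γ.src hl
      obtain ⟨h₁, h₂⟩ := h.split hab
      have e₁ := ih _ (by rw [← hn]; simp) h₁ rfl
      have e₂ := ih _ (by rw [← hn]; simp; omega) h₂ rfl
      simp only [List.map_append, List.prod_append] at e₁ ⊢
      rw [e₂, mul_one, e₁]

/-- On a strongly connected graph the admissible arc values are quotients of node values. -/
theorem Admissible.exists_potential {x : Γ.A → ℝ} (hx : Γ.Admissible x)
    (hΓ : Γ.StronglyConnected) [Nonempty Γ.V] :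
    ∃ p : Γ.V → ℝ, (∀ v, 0 < p v) ∧ ∀ a, x a = p (Γ.tgt a) / p (Γ.src a) := by
  obtain ⟨o⟩ := ‹Nonempty Γ.V›
  choose W hW using hΓ.exists_isWalk o
  choose R hR using fun v => hΓ.exists_isWalk v o
  -- Closing up makes every walk product nonzero, hence positive, although only `0 ≤ x` is assumed.
  have hWR : ∀ v, ((W v).map x).prod * ((R v).map x).prod = 1 := fun v => by
    simpa using hx.prod_closed ((hW v).append (hR v))
  have hpos : ∀ v, 0 < ((W v).map x).prod := fun v => by
    refine lt_of_le_of_ne (List.prod_nonneg ?_) (left_ne_zero_of_mul_eq_one (hWR v)).symm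
    simp only [List.mem_map]
    rintro _ ⟨a, -, rfl⟩
    exact hx.1 a
  refine ⟨fun v => ((W v).map x).prod, hpos, fun a => ?_⟩
  rw [eq_div_iff (hpos _).ne', mul_comm]
  -- `W (src a)`, then `a`, and `W (tgt a)` are both closed up by the same return walk `R (tgt a)`,
  -- so their products agree.
  have h := hx.prod_closed
    (((isWalk_concat.2 ⟨hW (Γ.src a), rfl⟩ : Γ.IsWalk o (W (Γ.src a) ++ [a]) _)).append
      (hR (Γ.tgt a)))
  simp only [List.map_append, List.prod_append, List.map_cons, List.map_nil, List.prod_cons,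
    List.prod_nil, mul_one] at h
  exact mul_right_cancel₀ (right_ne_zero_of_mul_eq_one (hWR (Γ.tgt a))) (h.trans (hWR _).symm)

theorem prod_potential {p : Γ.V → ℝ} (hp : ∀ v, 0 < p v) {v w : Γ.V} {l : List Γ.A}
    (h : Γ.IsWalk v l w) :
    (l.map fun a => p (Γ.tgt a) / p (Γ.src a)).prod = p w / p v := by
  induction l generalizing v with
  | nil => obtain rfl : v = w := h; simp [(hp v).ne']
  | cons a l ih =>
    obtain ⟨rfl, h⟩ := h
    rw [List.map_cons, List.prod_cons, ih h, mul_comm,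
      div_mul_div_cancel₀ (hp (Γ.tgt a)).ne']

theorem admissible_potential {p : Γ.V → ℝ} (hp : ∀ v, 0 < p v) :
    Γ.Admissible fun a => p (Γ.tgt a) / p (Γ.src a) := by
  refine ⟨fun a => (div_pos (hp _) (hp _)).le, ?_⟩
  rintro l ⟨⟨v, -, -, h⟩, -⟩
  rw [prod_potential hp h, div_self (hp v).ne']

end MGraph

/-! ### Walks and order in a rooted tree -/

namespace NodeTree

variable (T : NodeTree)

theorem exists_nodup_isWalk (v : T.V) : ∃ l : List T.A, l.Nodup ∧ T.IsWalk T.root l v := by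
  by_cases hv : v = T.root
  · exact ⟨[], List.nodup_nil, hv.symm⟩
  · obtain ⟨l, hl, -⟩ := T.existsUnique_path v hv
    exact ⟨l, hl.2⟩

/-- The walk from the root to a node. -/
noncomputable def walk (v : T.V) : List T.A := (T.exists_nodup_isWalk v).choose

theorem nodup_walk (v : T.V) : (T.walk v).Nodup := (T.exists_nodup_isWalk v).choose_spec.1

theorem isWalk_walk (v : T.V) : T.IsWalk T.root (T.walk v) v :=
  (T.exists_nodup_isWalk v).choose_spec.2

variable {T}

theorem eq_nil_of_isWalk_root {v : T.V} {l : List T.A} (h : T.IsWalk v l T.root) : l = [] := by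
  rcases List.eq_nil_or_concat' l with rfl | ⟨l', a, rfl⟩
  · rfl
  · exact absurd (MGraph.isWalk_concat.1 h).2 (T.tgt_ne_root a)

theorem eq_walk_of_nodup {v : T.V} {l : List T.A} (hl : l.Nodup) (h : T.IsWalk T.root l v) :
    l = T.walk v := by
  by_cases hv : v = T.root
  · subst hv
    rw [eq_nil_of_isWalk_root h, eq_nil_of_isWalk_root (T.isWalk_walk _)]
  · have key : ∀ k : List T.A, k.Nodup → T.IsWalk T.root k v → T.IsPath T.root k v := by
      refine fun k hk hw => ⟨?_, hk, hw⟩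
      rintro rfl
      exact hv hw.symm
    exact (T.existsUnique_path v hv).unique (key l hl h)
      (key _ (T.nodup_walk v) (T.isWalk_walk v))

theorem walk_tgt (a : T.A) : T.walk (T.tgt a) = T.walk (T.src a) ++ [a] := by
  symm
  refine eq_walk_of_nodup ?_ (MGraph.isWalk_concat.2 ⟨T.isWalk_walk _, rfl⟩)
  -- Otherwise the part of the walk before `a` would be a second, shorter walk to `src a` without
  -- repeated arcs.
  have ha : a ∉ T.walk (T.src a) := by
    intro ha
    obtain ⟨s, t, hst⟩ := List.append_of_mem ha
    have hn := T.nodup_walk (T.src a)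
    have hw := T.isWalk_walk (T.src a)
    rw [hst] at hn hw
    obtain ⟨u, h₁, h₂⟩ := MGraph.isWalk_append.1 hw
    obtain rfl : T.src a = u := h₂.1
    have := eq_walk_of_nodup (List.Nodup.of_append_left hn) h₁
    rw [hst] at this
    simpa using congrArg List.length this
  exact (T.nodup_walk _).append (List.nodup_singleton a) (by simpa using ha)

theorem tgt_injective : Function.Injective T.tgt := by
  intro a b h
  have := congrArg T.walk h
  rw [walk_tgt, walk_tgt] at this
  simpa using (List.append_inj' this rfl).2

theorem exists_tgt_eq {v : T.V} (hv : v ≠ T.root) : ∃ a, T.tgt a = v := by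
  have h := T.isWalk_walk v
  rcases List.eq_nil_or_concat' (T.walk v) with h' | ⟨l, a, h'⟩
  · rw [h'] at h
    exact absurd h.symm hv
  · rw [h'] at h
    exact ⟨a, (MGraph.isWalk_concat.1 h).2⟩

/-- Induction from the root along the arcs. -/
theorem induction_on {P : T.V → Prop} (root : P T.root)
    (step : ∀ a, P (T.src a) → P (T.tgt a)) (v : T.V) : P v := by
  induction hn : (T.walk v).length using Nat.strong_induction_on generalizing v with
  | _ n ih =>
    by_cases hv : v = T.root
    · exact hv ▸ root
    · obtain ⟨a, rfl⟩ := exists_tgt_eq hv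
      exact step a (ih _ (by rw [← hn, walk_tgt]; simp) _ rfl)

theorem walk_append {v w : T.V} {l : List T.A} (h : T.IsWalk v l w) :
    T.walk w = T.walk v ++ l := by
  induction l generalizing v with
  | nil => obtain rfl : v = w := h; simp
  | cons a l ih =>
    obtain ⟨rfl, h⟩ := h
    rw [ih h, walk_tgt, List.append_assoc, List.singleton_append]

theorem le_iff_exists_isWalk {v w : T.V} : T.Le v w ↔ ∃ l, T.IsWalk v l w := by
  constructor
  · rintro (rfl | ⟨l, hl⟩)
    · exact ⟨[], rfl⟩
    · exact ⟨l, hl.2.2⟩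
  · rintro ⟨l, hl⟩
    by_cases hvw : v = w
    · exact Or.inl hvw
    · exact Or.inr (hl.exists_isPath hvw)

theorem root_le (v : T.V) : T.Le T.root v :=
  le_iff_exists_isWalk.2 ⟨_, T.isWalk_walk v⟩

theorem le_root_iff {v : T.V} : T.Le v T.root ↔ v = T.root := by
  rw [le_iff_exists_isWalk]
  constructor
  · rintro ⟨l, hl⟩
    obtain rfl := eq_nil_of_isWalk_root hl
    exact hl
  · rintro rfl
    exact ⟨[], rfl⟩

theorem le_tgt_iff {v : T.V} {a : T.A} : T.Le v (T.tgt a) ↔ v = T.tgt a ∨ T.Le v (T.src a) := by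
  simp only [le_iff_exists_isWalk]
  constructor
  · rintro ⟨l, hl⟩
    rcases List.eq_nil_or_concat' l with rfl | ⟨l', b, rfl⟩
    · exact Or.inl hl
    · obtain ⟨h₁, h₂⟩ := MGraph.isWalk_concat.1 hl
      obtain rfl := tgt_injective h₂
      exact Or.inr ⟨l', h₁⟩
  · rintro (rfl | ⟨l, hl⟩)
    · exact ⟨[], rfl⟩
    · exact ⟨l ++ [a], MGraph.isWalk_concat.2 ⟨hl, rfl⟩⟩

theorem not_tgt_le_src (a : T.A) : ¬ T.Le (T.tgt a) (T.src a) := by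
  rw [le_iff_exists_isWalk]
  rintro ⟨l, hl⟩
  have := congrArg List.length (walk_append hl)
  rw [walk_tgt] at this
  simp at this

theorem intervalProd_root (y : T.V → ℝ) : T.intervalProd y T.root T.root = y T.root := by
  classical
  unfold intervalProd
  simp only [root_le, true_and, le_root_iff]
  rw [Finset.prod_filter]
  simp

theorem intervalProd_tgt (y : T.V → ℝ) (a : T.A) :
    T.intervalProd y T.root (T.tgt a) = y (T.tgt a) * T.intervalProd y T.root (T.src a) := by
  classical
  unfold intervalProd
  simp only [root_le, true_and, le_tgt_iff]
  rw [← Finset.prod_insert (by simpa using not_tgt_le_src a)]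
  congr 1
  ext u
  simp

theorem intervalProd_pos {y : T.V → ℝ} (hy : ∀ v, 0 < y v) (v w : T.V) :
    0 < T.intervalProd y v w :=
  Finset.prod_pos fun u _ => hy u

/-- Every node lies below a leaf. -/
theorem exists_isLeaf_le (v : T.V) : ∃ w, T.IsLeaf w ∧ T.Le v w := by
  obtain ⟨w, hw, hmax⟩ := Set.exists_max_image {w | T.Le v w} (fun w => (T.walk w).length)
    (Set.toFinite _) ⟨v, Or.inl rfl⟩
  refine ⟨w, ?_, hw⟩
  rintro a rfl
  have := hmax (T.tgt a) (le_tgt_iff.2 (Or.inr hw))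
  simp [walk_tgt] at this

end NodeTree

/-! ### Trees from parent functions; existence and finiteness -/

/-- The rooted tree given by a parent function that decreases a depth function. -/
def NodeTree.ofParent {V : Type} [Fintype V] [DecidableEq V] (r : V) (par : V → V)
    (d : V → ℕ) (hd : ∀ v, v ≠ r → d (par v) < d v) : NodeTree :=
  let Γ : MGraph := { V := V, A := {v : V // v ≠ r}, src := fun a => par a.1, tgt := fun a => a.1 }
  have ex : ∀ n : ℕ, ∀ v : V, d v = n → ∃ l : List Γ.A, Γ.IsWalk r l v := by
    intro n
    induction n using Nat.strong_induction_on with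
    | _ n ih =>
      intro v hv
      by_cases hr : v = r
      · exact ⟨[], hr.symm⟩
      · obtain ⟨l, hl⟩ := ih _ (hv ▸ hd v hr) (par v) rfl
        exact ⟨l ++ [(⟨v, hr⟩ : {v : V // v ≠ r})], MGraph.isWalk_concat.2 ⟨hl, rfl⟩⟩
  have un : ∀ (l k : List Γ.A) (v : V), Γ.IsWalk r l v → Γ.IsWalk r k v → l = k := by
    intro l
    induction l using List.reverseRecOn with
    | nil =>
      intro k v hl hk
      obtain rfl : r = v := hl
      rcases List.eq_nil_or_concat' k with rfl | ⟨k, b, rfl⟩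
      · rfl
      · exact absurd (MGraph.isWalk_concat.1 hk).2 b.2
    | append_singleton l a ih =>
      intro k v hl hk
      obtain ⟨hl', rfl⟩ := MGraph.isWalk_concat.1 hl
      rcases List.eq_nil_or_concat' k with rfl | ⟨k, b, rfl⟩
      · exact absurd (Eq.symm hk) a.2
      · obtain ⟨hk, hab⟩ := MGraph.isWalk_concat.1 hk
        have hba : b = a := Subtype.ext hab
        rw [hba] at hk ⊢
        rw [ih k _ hl' hk]
  { toMGraph := Γ
    root := r
    tgt_ne_root := fun a => a.2
    existsUnique_path := fun v hv => by
      obtain ⟨l, hl⟩ := ex _ v rfl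
      obtain ⟨k, hk⟩ := hl.exists_isPath (Ne.symm hv)
      exact ⟨k, hk, fun k' hk' => un _ _ _ hk'.2.2 hk.2.2⟩ }

namespace NodeTree

theorem intervalProd_eq {T : NodeTree} {y q : T.V → ℝ} (hr : y T.root = q T.root)
    (h : ∀ a, q (T.tgt a) = y (T.tgt a) * q (T.src a)) (v : T.V) :
    T.intervalProd y T.root v = q v :=
  induction_on (P := fun v => T.intervalProd y T.root v = q v) ((intervalProd_root y).trans hr)
    (fun a ha => by rw [intervalProd_tgt, ha, h]) v

section ofParent

variable {V : Type} [Fintype V] [DecidableEq V] {r : V} {par : V → V} {d : V → ℕ}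
  {hd : ∀ v, v ≠ r → d (par v) < d v}

theorem isLeaf_ofParent {v : V} :
    (ofParent r par d hd).IsLeaf v ↔ ∀ w, w ≠ r → par w ≠ v :=
  ⟨fun h w hw => h ⟨w, hw⟩, fun h a => h a.1 a.2⟩

/-- Node values with prescribed products over the intervals from the root. -/
theorem admissible_ofParent {q : V → ℝ} (hq : ∀ v, 0 < q v)
    (hleaf : ∀ v, (ofParent r par d hd).IsLeaf v → q v = 1) :
    (ofParent r par d hd).Admissible fun v : V => if v = r then q r else q v / q (par v) := by
  refine ⟨fun (v : V) => ?_, fun v hv => ?_⟩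
  · change 0 < if v = r then q r else q v / q (par v)
    split_ifs
    · exact hq _
    · exact div_pos (hq _) (hq _)
  · rw [← hleaf v hv]
    refine intervalProd_eq (T := ofParent r par d hd) (q := q) (if_pos rfl) (fun a => ?_) v
    change q a.1 = (if a.1 = r then _ else _) * q (par a.1)
    have : a.1 ≠ r := a.2
    rw [if_neg this]
    exact (div_mul_cancel₀ _ (hq _).ne').symm

theorem ofParent_mem_rootedTrees {m l : ℕ} (hm : Fintype.card V = m) (S : Finset V)
    (hl : S.card = l) (hS : ∀ v, v ∈ S ↔ ∀ w, w ≠ r → par w ≠ v) :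
    ofParent r par d hd ∈ rootedTrees m l := by
  refine ⟨hm, ?_⟩
  rw [← hl, ← Set.ncard_coe_finset]
  congr 1
  ext v
  exact isLeaf_ofParent.trans (hS v).symm

end ofParent

/-- A tree with `m` nodes of which `l < m` are leaves. -/
theorem rootedTrees_nonempty {m l : ℕ} (hl : 1 ≤ l) (hlm : l < m) : (rootedTrees m l).Nonempty := by
  obtain ⟨k, rfl⟩ : ∃ k, m = l + k + 1 := ⟨m - l - 1, by omega⟩
  let r : Fin (l + k + 1) := ⟨0, by omega⟩
  -- The path `0, ..., k` with the remaining `l` nodes attached to `k` as leaves.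
  let par : Fin (l + k + 1) → Fin (l + k + 1) := fun i => ⟨min (i - 1) k, by omega⟩
  have hd : ∀ v, v ≠ r → (par v : ℕ) < (v : ℕ) := by
    intro v hv
    have : (v : ℕ) ≠ 0 := fun h => hv (Fin.ext h)
    simp only [par]
    omega
  refine ⟨ofParent r par (fun i => i) hd, ofParent_mem_rootedTrees (Fintype.card_fin _)
    (Finset.Ioi ⟨k, by omega⟩) (by simp) fun v => ?_⟩
  simp only [Finset.mem_Ioi, Fin.lt_def]
  constructor
  · rintro h w - rfl
    simp only [par] at h
    omega
  · intro h
    by_contra hv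
    have hv' : (v : ℕ) ≤ k := not_lt.1 hv
    refine h ⟨v + 1, by omega⟩ (fun h => ?_) (Fin.ext ?_)
    · simpa [r] using congrArg Fin.val h
    · simp only [par]
      omega

/-- There are only finitely many values of `m_T` on the trees with `m` nodes. -/
theorem finite_mMin_image (m l : ℕ) : (mMin '' rootedTrees m l).Finite := by
  classical
  -- `m_T` depends only on the order, the leaves and the root; on `Fin m` there are finitely many
  -- such triples.
  let g : (Fin m → Fin m → Prop) × (Fin m → Prop) × Fin m → ℝ := fun D =>
    sInf {s | ∃ y : Fin m → ℝ, ((∀ v, 0 < y v) ∧ ∀ v, D.2.1 v →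
      ∏ u with D.1 D.2.2 u ∧ D.1 u v, y u = 1) ∧ s = ∑ v, y v}
  refine (Set.finite_range g).subset ?_
  rintro _ ⟨T, ⟨hm, -⟩, rfl⟩
  let e : T.V ≃ Fin m := Fintype.equivFinOfCardEq hm
  refine ⟨⟨fun i j => T.Le (e.symm i) (e.symm j), fun i => T.IsLeaf (e.symm i), e T.root⟩, ?_⟩
  unfold mMin nodeSums Admissible intervalProd
  simp only [g, Equiv.symm_apply_apply]
  congr 1
  ext s
  have key : ∀ (y : Fin m → ℝ) (v : T.V),
      ∏ u with T.Le T.root u ∧ T.Le u v, y (e u) =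
        ∏ u with T.Le T.root (e.symm u) ∧ T.Le (e.symm u) v, y u := by
    intro y v
    rw [Finset.prod_filter, Finset.prod_filter]
    exact Fintype.prod_equiv e _ _ (fun u => by simp)
  constructor
  · rintro ⟨y, ⟨h₁, h₂⟩, rfl⟩
    refine ⟨fun v => y (e v), ⟨fun v => h₁ _, fun v hv => ?_⟩, (e.sum_comp y).symm⟩
    have := h₂ (e v) (by simpa using hv)
    rw [Equiv.symm_apply_apply] at this
    convert (key y v).trans this
  · rintro ⟨y, ⟨h₁, h₂⟩, rfl⟩
    refine ⟨fun i => y (e.symm i), ⟨fun v => h₁ _, fun v hv => ?_⟩, (e.symm.sum_comp y).symm⟩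
    have := h₂ (e.symm v) hv
    rw [← key]
    simp only [Equiv.symm_apply_apply]
    convert this

end NodeTree

/-! ### Attainment of the minima -/

/-- Nonnegative points whose sum does not exceed that of a given point lie in a compact box. -/
theorem isLeast_sInf_sum {ι : Type*} [Fintype ι] {K : Set (ι → ℝ)} (hK : IsClosed K)
    (h0 : ∀ x ∈ K, ∀ i, 0 ≤ x i) (hne : K.Nonempty) :
    IsLeast {s | ∃ x, x ∈ K ∧ s = ∑ i, x i} (sInf {s | ∃ x, x ∈ K ∧ s = ∑ i, x i}) := by
  obtain ⟨z, hz⟩ := hne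
  have hcomp : IsCompact (K ∩ Set.Icc (0 : ι → ℝ) fun _ => ∑ i, z i) :=
    isCompact_Icc.inter_left hK
  have hle : ∀ x ∈ K, ∀ i, x i ≤ ∑ i, x i := fun x hx i =>
    Finset.single_le_sum (fun j _ => h0 x hx j) (Finset.mem_univ i)
  obtain ⟨x, ⟨hxK, -⟩, hx⟩ := hcomp.exists_isMinOn ⟨z, hz, h0 z hz, hle z hz⟩
    (f := fun x : ι → ℝ => ∑ i, x i) (by fun_prop)
  have : IsLeast {s | ∃ x, x ∈ K ∧ s = ∑ i, x i} (∑ i, x i) := by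
    refine ⟨⟨x, hxK, rfl⟩, ?_⟩
    rintro _ ⟨w, hw, rfl⟩
    by_cases hwz : ∑ i, w i ≤ ∑ i, z i
    · exact hx ⟨hw, h0 w hw, fun i => (hle w hw i).trans hwz⟩
    · exact (hx ⟨hz, h0 z hz, hle z hz⟩ : ∑ i, x i ≤ ∑ i, z i).trans (not_le.1 hwz).le
  exact this.csInf_eq.symm ▸ this

theorem MGraph.isLeast_fMin (Γ : MGraph) : IsLeast Γ.arcSums Γ.fMin := by
  refine isLeast_sInf_sum (K := {x | Γ.Admissible x}) ?_ (fun x hx => hx.1)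
    ⟨fun _ => 1, fun _ => zero_le_one, fun l _ => by simp⟩
  have : {x | Γ.Admissible x} = (⋂ a, {x : Γ.A → ℝ | 0 ≤ x a}) ∩
      ⋂ l : {l // Γ.IsCycle l}, {x : Γ.A → ℝ | (l.1.map x).prod = 1} := by
    ext x
    simp [Admissible]
  rw [this]
  refine (isClosed_iInter fun a => isClosed_le continuous_const (continuous_apply a)).inter
    (isClosed_iInter fun l => isClosed_eq ?_ continuous_const)
  exact continuous_list_prod _ fun a _ => continuous_apply a

theorem NodeTree.isLeast_mMin (T : NodeTree) : IsLeast T.nodeSums T.mMin := by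
  classical
  refine isLeast_sInf_sum (K := {y | T.Admissible y}) ?_ (fun y hy v => (hy.1 v).le)
    ⟨fun _ => 1, fun _ => zero_lt_one, fun v _ => by simp [intervalProd]⟩
  -- Positivity is not a closed condition, but `0 ≤ y` suffices: each node lies below a leaf, where
  -- a zero factor would spoil the product `1`.
  have : {y | T.Admissible y} = (⋂ v, {y : T.V → ℝ | 0 ≤ y v}) ∩
      ⋂ v : {v // T.IsLeaf v}, {y : T.V → ℝ | T.intervalProd y T.root v.1 = 1} := by
    ext y
    simp only [Admissible, Set.mem_ofPred_eq, Set.mem_inter_iff, Set.mem_iInter, Subtype.forall]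
    refine ⟨fun h => ⟨fun v => (h.1 v).le, h.2⟩, fun h => ⟨fun v => ?_, h.2⟩⟩
    refine lt_of_le_of_ne (h.1 v) fun hv => ?_
    obtain ⟨w, hw, hvw⟩ := exists_isLeaf_le v
    refine zero_ne_one (α := ℝ) ?_
    rw [← h.2 w hw, intervalProd]
    exact (Finset.prod_eq_zero (i := v) (by simp [root_le, hvw]) hv.symm).symm
  rw [this]
  refine (isClosed_iInter fun a => isClosed_le continuous_const (continuous_apply a)).inter
    (isClosed_iInter fun l => isClosed_eq ?_ continuous_const)
  unfold intervalProd
  exact continuous_finsetProd _ fun a _ => continuous_apply a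

/-! ### From graphs to trees -/

namespace MGraph

variable {Γ : MGraph}

/-- The last arcs of shortest walks from `o`. -/
theorem exists_distance [Nonempty Γ.A] (o : Γ.V) (h : ∀ v, ∃ l, Γ.IsWalk o l v) :
    ∃ (d : Γ.V → ℕ) (e : Γ.V → Γ.A), ∀ v, v ≠ o → Γ.tgt (e v) = v ∧ d (Γ.src (e v)) < d v := by
  classical
  have hex : ∀ v, ∃ n, ∃ l, Γ.IsWalk o l v ∧ l.length = n := fun v =>
    (h v).imp' List.length fun l hl => ⟨l, hl, rfl⟩
  have key : ∀ v, v ≠ o → ∃ a, Γ.tgt a = v ∧ Nat.find (hex (Γ.src a)) < Nat.find (hex v) := by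
    intro v hv
    obtain ⟨l, hl, hn⟩ := Nat.find_spec (hex v)
    rcases List.eq_nil_or_concat' l with rfl | ⟨l, a, rfl⟩
    · exact absurd (Eq.symm hl) hv
    · obtain ⟨hl, ha⟩ := isWalk_concat.1 hl
      refine ⟨a, ha, ?_⟩
      rw [← hn]
      exact (Nat.find_le ⟨l, hl, rfl⟩).trans_lt (by simp)
  choose! e he using key
  exact ⟨fun v => Nat.find (hex v), e, he⟩

/-- An admissible valuation of a strongly connected graph is improved by a tree. -/
theorem exists_tree_le {m n : ℕ} (hn : 2 ≤ n) (hmn : n ≤ m)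
    (hΓ : Γ ∈ stronglyConnectedGraphs m n)
    {x : Γ.A → ℝ} (hx : Γ.Admissible x) :
    ∃ T ∈ rootedTrees m (m - n + 1), ∃ s ∈ T.nodeSums, s ≤ ∑ a, x a := by
  classical
  obtain ⟨hsc, hm, hn'⟩ := hΓ
  have : Nontrivial Γ.V := Fintype.one_lt_card_iff_nontrivial.1 (by omega)
  obtain ⟨p, hp, hxp⟩ := hx.exists_potential hsc
  obtain ⟨o, ho⟩ := Finite.exists_min p
  obtain ⟨u, hu⟩ := exists_ne o
  obtain ⟨l, hl, -⟩ := hsc u o hu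
  have : Nonempty Γ.A := ⟨l.head hl⟩
  obtain ⟨d, e, hde⟩ := exists_distance o (hsc.exists_isWalk o)
  -- As `r` is nearest to `o`, the arc `e r` starts at `o`; it will be the root.
  obtain ⟨r, hro, hr⟩ : ∃ r, r ≠ o ∧ ∀ v, v ≠ o → d r ≤ d v :=
    Set.exists_min_image {v | v ≠ o} d (Set.toFinite _) ⟨u, hu⟩
  have hsr : Γ.src (e r) = o := by
    by_contra h
    exact absurd (hde r hro).2 (not_lt.2 (hr _ h))
  -- The new source of `a`; the parent of `a` will be `e (w a)`.
  let w : Γ.A → Γ.V := fun a => if Γ.src a = o then r else Γ.src a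
  have hwo : ∀ a, w a ≠ o := by
    intro a
    simp only [w]
    split_ifs with h
    · exact hro
    · exact h
  have hwp : ∀ a, p (Γ.src a) ≤ p (w a) := by
    intro a
    simp only [w]
    split_ifs with h
    · exact h ▸ ho r
    · exact le_rfl
  -- The new target of `a`; the choice of `o` makes `p` no larger there.
  let t : Γ.A → Γ.V := fun a => if a = e (Γ.tgt a) then Γ.tgt a else o
  have htp : ∀ a, p (t a) ≤ p (Γ.tgt a) := by
    intro a
    simp only [t]
    split_ifs with h
    · exact le_rfl
    · exact ho _
  have hte : ∀ v, v ≠ o → t (e v) = v := fun v hv => by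
    simp only [t, (hde v hv).1, if_true]
  have hinj : Set.InjOn e {v | v ≠ o} := fun u hu v hv huv => by
    rw [← (hde u hu).1, huv, (hde v hv).1]
  let D : Γ.A → ℕ := fun b => if b = e r then 0 else d (Γ.src b) + 1
  have hD : ∀ a, a ≠ e r → D (e (w a)) < D a := by
    intro a ha
    simp only [D, if_neg ha]
    split_ifs with h
    · omega
    · have hs : Γ.src a ≠ o := fun hs => h (by simp [w, hs])
      have : w a = Γ.src a := if_neg hs
      rw [this]
      have := (hde _ hs).2
      omega
  -- Strong connectedness gives an arc out of `v`; it is not `e r`, which starts at `o`, so it is a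
  -- child of `e v`.
  have hnonleaf : ∀ v, v ≠ o → ∃ b, b ≠ e r ∧ e (w b) = e v := by
    intro v hv
    obtain ⟨l, hl, -, hw⟩ := hsc v o hv
    rcases l with _ | ⟨b, l⟩
    · exact absurd rfl hl
    · have hb : Γ.src b = v := hw.1
      refine ⟨b, ?_, ?_⟩
      · rintro rfl
        exact hv (hb ▸ hsr)
      · rw [← hb] at hv ⊢
        simp only [w, if_neg hv]
  let T := NodeTree.ofParent (e r) (fun a => e (w a)) D hD
  have hcard : ((Finset.univ.erase o).image e)ᶜ.card = m - n + 1 := by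
    rw [Finset.card_compl, Finset.card_image_of_injOn (by simpa [Set.InjOn] using hinj),
      Finset.card_erase_of_mem (Finset.mem_univ o), Finset.card_univ, hm, hn']
    omega
  have hT : T ∈ rootedTrees m (m - n + 1) := by
    refine NodeTree.ofParent_mem_rootedTrees hm _ hcard fun a => ?_
    simp only [Finset.mem_compl, Finset.mem_image, Finset.mem_erase, Finset.mem_univ, and_true,
      not_exists, not_and]
    constructor
    · exact fun h b _ => h _ (hwo b)
    · rintro h v hv rfl
      obtain ⟨b, hb, hbv⟩ := hnonleaf v hv
      exact h b hb hbv
  have hleaf : ∀ a, T.IsLeaf a → p (t a) / p o = 1 := by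
    intro a ha
    replace ha := NodeTree.isLeaf_ofParent.1 ha
    by_cases hta : t a = o
    · rw [hta, div_self (hp o).ne']
    · have h : a = e (Γ.tgt a) := by
        by_contra h
        exact hta (if_neg h)
      have h' : Γ.tgt a ≠ o := fun h' => hta ((if_pos h).trans h')
      obtain ⟨b, hb, hbv⟩ := hnonleaf _ h'
      exact absurd (hbv.trans h.symm) (ha b hb)
  refine ⟨T, hT, _, ⟨_, NodeTree.admissible_ofParent (hd := hD) (q := fun a => p (t a) / p o)
    (fun a => div_pos (hp _) (hp _)) hleaf, rfl⟩, ?_⟩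
  refine Finset.sum_le_sum fun (a : Γ.A) _ => ?_
  change (if a = e r then p (t (e r)) / p o else p (t a) / p o / (p (t (e (w a))) / p o)) ≤ x a
  split_ifs with h
  · rw [h, hxp, hte r hro, hsr, (hde r hro).1]
  -- Here the node value is `p (t a) / p (w a)`: smaller numerator, larger denominator than in `x
  -- a`.
  · rw [hte _ (hwo a), div_div_div_cancel_right₀ (hp o).ne', hxp]
    exact div_le_div₀ (hp _).le (htp a) (hp _) (hwp a)

end MGraph

/-! ### From trees to graphs -/

namespace NodeTree

variable (T : NodeTree)

open Classical in
/-- The graph obtained from a rooted tree by identifying all leaves with a new node `none`, from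
which a new arc leads to the root. The arc ending at the node `v` of the tree is called `v`. -/
noncomputable def closure : MGraph where
  V := Option {v : T.V // ¬ T.IsLeaf v}
  A := T.V
  src v := if h : v = T.root then none else
    some ⟨T.src (exists_tgt_eq h).choose, fun h' => h' _ rfl⟩
  tgt v := if h : T.IsLeaf v then none else some ⟨v, h⟩

variable {T}

theorem closure_src_root : T.closure.src T.root = none := dif_pos rfl

theorem closure_src_tgt (a : T.A) :
    T.closure.src (T.tgt a) = some ⟨T.src a, fun h => h a rfl⟩ := by
  have h := (exists_tgt_eq (T.tgt_ne_root a)).choose_spec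
  refine (dif_neg (T.tgt_ne_root a)).trans ?_
  congr 2
  exact congrArg T.src (tgt_injective h)

theorem closure_tgt_of_isLeaf {v : T.V} (h : T.IsLeaf v) : T.closure.tgt v = none := dif_pos h

theorem closure_tgt_of_not_isLeaf {v : T.V} (h : ¬ T.IsLeaf v) :
    T.closure.tgt v = some ⟨v, h⟩ := dif_neg h

theorem stronglyConnected_closure (T : NodeTree) : T.closure.StronglyConnected := by
  have h₁ : ∀ v, ∃ l, T.closure.IsWalk none l (T.closure.tgt v) := by
    refine induction_on (T := T) (P := fun v => ∃ l, T.closure.IsWalk none l (T.closure.tgt v))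
      ⟨[T.root], closure_src_root, rfl⟩ ?_
    rintro a ⟨l, hl⟩
    refine ⟨l ++ ([T.tgt a] : List T.closure.A), MGraph.isWalk_concat.2 ⟨?_, rfl⟩⟩
    rwa [closure_src_tgt, ← closure_tgt_of_not_isLeaf]
  have h₂ : ∀ (l : List T.A) (v w : T.V), T.IsWalk v l w → T.IsLeaf w →
      ∃ l, T.closure.IsWalk (T.closure.tgt v) l none := by
    intro l
    induction l with
    | nil =>
      intro v w h hw
      obtain rfl : v = w := h
      exact ⟨[], closure_tgt_of_isLeaf hw⟩
    | cons a l ih =>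
      rintro v w ⟨rfl, h⟩ hw
      obtain ⟨k, hk⟩ := ih _ w h hw
      refine ⟨T.tgt a :: k, ?_, hk⟩
      rw [closure_src_tgt, closure_tgt_of_not_isLeaf]
  refine MGraph.stronglyConnected_of_base (Γ := T.closure) none ?_ ?_
  · rintro (_ | ⟨v, hv⟩)
    · exact ⟨[], rfl⟩
    · rw [← closure_tgt_of_not_isLeaf]
      exact h₁ v
  · rintro (_ | ⟨v, hv⟩)
    · exact ⟨[], rfl⟩
    · rw [← closure_tgt_of_not_isLeaf]
      obtain ⟨w, hw, hvw⟩ := exists_isLeaf_le v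
      obtain ⟨l, hl⟩ := le_iff_exists_isWalk.1 hvw
      exact h₂ l v w hl hw

theorem admissible_closure {y : T.V → ℝ} (hy : T.Admissible y) :
    T.closure.Admissible (y : T.closure.A → ℝ) := by
  -- The value `1` at the glued node is consistent because the product up to each leaf is `1`.
  let p : T.closure.V → ℝ := fun v => v.elim 1 fun u => T.intervalProd y T.root u.1
  have hp : ∀ v, 0 < p v := by
    rintro (_ | ⟨v, hv⟩)
    · exact zero_lt_one
    · exact intervalProd_pos hy.1 _ _
  have htgt : ∀ v, p (T.closure.tgt v) = T.intervalProd y T.root v := by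
    intro v
    by_cases hv : T.IsLeaf v
    · rw [closure_tgt_of_isLeaf hv, hy.2 v hv]
      rfl
    · rw [closure_tgt_of_not_isLeaf hv]
      rfl
  have hsrc : ∀ v : T.V, y v * p (T.closure.src v) = T.intervalProd y T.root v := by
    intro v
    by_cases hv : v = T.root
    · subst hv
      rw [closure_src_root, intervalProd_root]
      exact mul_one _
    · obtain ⟨a, rfl⟩ := exists_tgt_eq hv
      rw [closure_src_tgt, intervalProd_tgt]
      rfl
  have key : y = fun a : T.closure.A => p (T.closure.tgt a) / p (T.closure.src a) :=
    funext fun v => eq_div_of_mul_eq (hp _).ne' ((hsrc v).trans (htgt v).symm)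
  exact key ▸ MGraph.admissible_potential hp

theorem closure_mem {m n : ℕ} (hn : 2 ≤ n) (hmn : n ≤ m) (hT : T ∈ rootedTrees m (m - n + 1)) :
    T.closure ∈ stronglyConnectedGraphs m n := by
  classical
  obtain ⟨hm, hl⟩ := hT
  refine ⟨stronglyConnected_closure T, hm, ?_⟩
  have : Fintype.card T.closure.V = Fintype.card (Option {v : T.V // ¬ T.IsLeaf v}) :=
    Fintype.card_congr (Equiv.refl _)
  rw [this, Fintype.card_option, Fintype.card_subtype_compl, hm]
  have : Fintype.card {v // T.IsLeaf v} = m - n + 1 := by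
    rw [← hl, ← Nat.card_coe_set_eq, Nat.card_eq_fintype_card]
    rfl
  omega

end NodeTree

theorem mainTheorem4 (m n : ℕ) (hn : 2 ≤ n) (hmn : n ≤ m) :
    (∀ Γ ∈ stronglyConnectedGraphs m n, IsLeast Γ.arcSums Γ.fMin) ∧
    (∀ T ∈ rootedTrees m (m - n + 1), IsLeast T.nodeSums T.mMin) ∧
    ∃ c : ℝ, IsLeast (MGraph.fMin '' stronglyConnectedGraphs m n) c ∧
      IsLeast (NodeTree.mMin '' rootedTrees m (m - n + 1)) c := by
  refine ⟨fun Γ _ => Γ.isLeast_fMin, fun T _ => T.isLeast_mMin, ?_⟩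
  obtain ⟨c, hc, hmin⟩ := Set.exists_min_image _ (fun c : ℝ => c)
    (NodeTree.finite_mMin_image m (m - n + 1))
    ((NodeTree.rootedTrees_nonempty (by omega) (by omega)).image _)
  have hlow : ∀ Γ ∈ stronglyConnectedGraphs m n, c ≤ Γ.fMin := by
    intro Γ hΓ
    obtain ⟨x, hx, hs⟩ := Γ.isLeast_fMin.1
    obtain ⟨T', hT', s, hsT, hle⟩ := MGraph.exists_tree_le hn hmn hΓ hx
    rw [hs]
    exact (hmin _ ⟨T', hT', rfl⟩).trans ((T'.isLeast_mMin.2 hsT).trans hle)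
  refine ⟨c, ⟨?_, ?_⟩, hc, hmin⟩
  · obtain ⟨T', hT', rfl⟩ := hc
    have hmem := NodeTree.closure_mem hn hmn hT'
    refine ⟨_, hmem, le_antisymm ?_ (hlow _ hmem)⟩
    obtain ⟨y, hy, hs⟩ := T'.isLeast_mMin.1
    exact T'.closure.isLeast_fMin.2 ⟨y, NodeTree.admissible_closure hy, hs⟩
  · rintro _ ⟨Γ, hΓ, rfl⟩
    exact hlow Γ hΓ
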